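/- Let $\mathbb D=\{z\in\mathbb C:|z|<1\}$ and let $\mathcal O(U,V)$ denote the set of holomorphic maps $U\to V$. Let $D\subsetneq\mathbb C$ be a simply connected domain that contains $[-1,1]$ and is symmetric with respect to the real axis ($z\in D$ iff $\bar z\in D$). Let $\alpha$ be a finite, nonzero, positive Borel measure on $[-1,1]$ that is absolutely continuous with respect to Lebesgue measure. Let $n\ge 1$, let $-1\le x_1<\dots<x_n\le 1$, and let $k_1,\dots,k_n$ be positive integers; write $X=(x_1,\dots,x_n)$, $\mathcal K=(k_1,\dots,k_n)$. For an integer $k$ let $r(k)$ be the least even integer that is at least $k$. Let $\mathcal F_+(D;X;\mathcal K)$ be the set of all $f\in\mathcal O(D,\mathbb D)$ such that $f^{(l)}(x_j)=0$ for $0\le l\le k_j-1$, $1\le j\le n$, and such that $f$ is real and nonnegative on $D\cap\mathbb R$. Put $$J_+(D;X;\mathcal K)=\sup\Big\{\Big|\int_{-1}^1 g\,d\alpha\Big| : g\in\mathcal F_+(D;X;\mathcal K)\Big\}.$$ For $w,z\in\mathbb D$ put $m(w,z)=\left|\frac{w-z}{1-\bar w z}\right|$ and $p(w,z)=\frac12\ln\frac{1+m(w,z)}{1-m(w,z)}$,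 and for $w,z\in D$ put $c_D(w,z)=\sup\{p(F(w),F(z)):F\in\mathcal O(D,\mathbb D)\}$ and $c_D^*(w,z)=\tanh c_D(w,z)$. Then there is exactly one biholomorphic map $f_D:D\to\mathbb D$ with $f_D(0)=0$ and $f_D([0,1])\subset[0,1)$. There is exactly one $f\in\mathcal F_+(D;X;\mathcal K)$ with $\int_{-1}^1 f\,d\alpha=J_+(D;X;\mathcal K)$. It is given by $$f(z)=\prod_{j=1}^n\left(\frac{f_D(z)-f_D(x_j)}{1-f_D(x_j)f_D(z)}\right)^{r(k_j)},\qquad z\in D,$$ and $$J_+(D;X;\mathcal K)=\int_{-1}^1\prod_{j=1}^n c_D^*(x,x_j)^{r(k_j)}\,d\alpha(x)=\int_{-1}^1\prod_{j=1}^n m(f_D(x),f_D(x_j))^{r(k_j)}\,d\alpha(x).$$ -/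

import Mathlib

open Set MeasureTheory

noncomputable section

/-- `f` is a holomorphic map from `U` into `V` (only its values on `U` matter). -/
def IsHolMap (U V : Set ℂ) (f : ℂ → ℂ) : Prop :=
  DifferentiableOn ℂ f U ∧ MapsTo f U V

/-- `f` maps `U` biholomorphically onto `V`. -/
def IsBiholomorphic (U V : Set ℂ) (f : ℂ → ℂ) : Prop :=
  IsHolMap U V f ∧ ∃ g : ℂ → ℂ, IsHolMap V U g ∧ InvOn g f U V

/-- The open unit disc of the complex plane. -/
def disc : Set ℂ := Metric.ball 0 1

/-- The Möbius (pseudo-hyperbolic) distance `m` on the unit disc. -/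
def moebiusDist (w z : ℂ) : ℝ :=
  ‖(w - z) / (1 - (starRingEnd ℂ) w * z)‖

/-- The Poincaré distance `p` on the unit disc. -/
def poincareDist (w z : ℂ) : ℝ :=
  1 / 2 * Real.log ((1 + moebiusDist w z) / (1 - moebiusDist w z))

/-- The Carathéodory pseudodistance `c_D`. -/
def caratheodoryDist (D : Set ℂ) (w z : ℂ) : ℝ :=
  sSup {t : ℝ | ∃ F : ℂ → ℂ, IsHolMap D disc F ∧ t = poincareDist (F w) (F z)}

/-- `c_D^* = tanh c_D`. -/
def caratheodoryStar (D : Set ℂ) (w z : ℂ) : ℝ :=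
  Real.tanh (caratheodoryDist D w z)

/-- The normalized Riemann map `f_D`: a biholomorphic map of `D` onto the unit disc with
`f_D(0) = 0` and `f_D([0,1]) ⊆ [0,1)`. -/
def IsNormalizedRiemannMap (D : Set ℂ) (φ : ℂ → ℂ) : Prop :=
  IsBiholomorphic D disc φ ∧ φ 0 = 0 ∧
    ∀ x ∈ Icc (0 : ℝ) 1, ∃ t ∈ Ico (0 : ℝ) 1, φ (x : ℂ) = (t : ℂ)

/-- `r(k)`: the least even integer that is at least `k`. -/
def evenCeil (k : ℕ) : ℕ := if Even k then k else k + 1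

theorem isLeast_evenCeil (k : ℕ) : IsLeast {m : ℕ | Even m ∧ k ≤ m} (evenCeil k) := by
  unfold evenCeil
  split_ifs with h
  · exact ⟨⟨h, le_rfl⟩, fun m hm => hm.2⟩
  · refine ⟨⟨Nat.even_add_one.mpr h, Nat.le_succ k⟩, fun m hm => ?_⟩
    rcases Nat.lt_or_ge k m with h' | h'
    · exact h'
    · exact absurd ((le_antisymm hm.2 h') ▸ hm.1) h

/-- The class `F(D; X; K)`. -/
def classF (D : Set ℂ) {n : ℕ} (x : Fin n → ℝ) (k : Fin n → ℕ) : Set (ℂ → ℂ) :=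
  {f | IsHolMap D disc f ∧ ∀ j, ∀ l < k j, iteratedDeriv l f (x j : ℂ) = 0}

/-- The class `F_r(D; X; K)`: those members that are real on `D ∩ ℝ`. -/
def classFReal (D : Set ℂ) {n : ℕ} (x : Fin n → ℝ) (k : Fin n → ℕ) : Set (ℂ → ℂ) :=
  {f | f ∈ classF D x k ∧ ∀ t : ℝ, (t : ℂ) ∈ D → (f t).im = 0}

/-- The class `F_+(D; X; K)`: those members that are real and nonnegative on `D ∩ ℝ`. -/
def classFPos (D : Set ℂ) {n : ℕ} (x : Fin n → ℝ) (k : Fin n → ℕ) : Set (ℂ → ℂ) :=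
  {f | f ∈ classFReal D x k ∧ ∀ t : ℝ, (t : ℂ) ∈ D → 0 ≤ (f t).re}

/-- `J_+(D; X; K)`, the supremum of `|∫ g dα|` over `g ∈ F_+(D; X; K)`. -/
def JPos (D : Set ℂ) (α : Measure ℝ) {n : ℕ} (x : Fin n → ℝ) (k : Fin n → ℕ) : ℝ :=
  sSup {s : ℝ | ∃ g ∈ classFPos D x k, s = ‖∫ t in Icc (-1 : ℝ) 1, g (t : ℂ) ∂α‖}

end

/-!
The Riemann map of `D` with `φ(0) = 0` and `φ(1) > 0` exists by the Riemann mapping theorem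
(`exists_isBiholomorphic_disc`), which is proved here by Koebe's argument: among the injective
immersions of `D` into the disc vanishing at `p`, one that maximises the modulus at another point
`q` exists by Montel's and Hurwitz's theorems, and it is onto, since otherwise a square root would
give a larger one. By the equality case of the Schwarz lemma two Riemann maps with a common zero
differ by a rotation. Hence `φ` is unique, it commutes with conjugation when `D` is symmetric, it
is real on `D ∩ ℝ`, and by the intermediate value theorem it is nonnegative on `[0, 1]`.

Let `g` be a competitor. As `g` does not change sign on the real axis, its zero at each `x_j` has
even or infinite order (`evenCeil_le_analyticOrderAt`), so the order is at least `r(k_j)`.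
Transported to the disc, these zeros can be divided out one Blaschke factor at a time without leaving the closed disc,
by the Schwarz lemma (`exists_eq_prod_moeb_mul`). Thus `g = B u` with `B` the Blaschke product of
the theorem and `|u| ≤ 1` (`exists_eq_blaschke_mul`). All exponents in `B` are even, so `B` is
itself a competitor, and `0 ≤ g ≤ B` on the interval gives the value of the supremum. If the integrals
of `g` and `B` agree, then `g = B` holds `α`-almost everywhere, in particular at a point that is not
among the `x_j`, because `α` has no atoms; there `u = 1`, and the maximum principle gives `u = 1`
on all of `D`.

The formula with the Carathéodory distance is the Schwarz–Pick lemma: the supremum defining `c_D` is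
attained at `φ` (`caratheodoryStar_eq_moebiusDist`).
-/

open Filter Metric
open scoped ComplexConjugate Topology

/-! ### Möbius maps of the unit disc -/

theorem mem_disc {z : ℂ} : z ∈ disc ↔ ‖z‖ < 1 := mem_ball_zero_iff

theorem isOpen_disc : IsOpen disc := isOpen_ball

/-- The automorphism `z ↦ (z - a) / (1 - ā z)` of the unit disc sending `a` to `0`. -/
noncomputable def moeb (a z : ℂ) : ℂ := (z - a) / (1 - conj a * z)

theorem one_sub_conj_mul_ne_zero {a z : ℂ} (ha : a ∈ disc) (hz : z ∈ disc) :
    1 - conj a * z ≠ 0 := by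
  rw [mem_disc] at ha hz
  intro h
  have h1 : ‖conj a * z‖ = 1 := by rw [← sub_eq_zero.mp h, norm_one]
  rw [norm_mul, RCLike.norm_conj] at h1
  nlinarith [norm_nonneg a, norm_nonneg z]

@[simp] theorem moeb_self (a : ℂ) : moeb a a = 0 := by simp [moeb]

@[simp] theorem moeb_zero_right (a : ℂ) : moeb a 0 = -a := by simp [moeb]

theorem moeb_eq_zero_iff {a z : ℂ} (ha : a ∈ disc) (hz : z ∈ disc) : moeb a z = 0 ↔ z = a := by
  rw [moeb, div_eq_zero_iff, or_iff_left (one_sub_conj_mul_ne_zero ha hz), sub_eq_zero]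

theorem moeb_mem_disc {a z : ℂ} (ha : a ∈ disc) (hz : z ∈ disc) : moeb a z ∈ disc := by
  have hne := one_sub_conj_mul_ne_zero ha hz
  rw [mem_disc] at *
  rw [moeb, norm_div, div_lt_one (norm_pos_iff.mpr hne)]
  refine lt_of_pow_lt_pow_left₀ 2 (norm_nonneg _) ?_
  have ha2 : ‖a‖ ^ 2 < 1 := by nlinarith [norm_nonneg a]
  have hz2 : ‖z‖ ^ 2 < 1 := by nlinarith [norm_nonneg z]
  -- `|1 - ā z|² - |z - a|² = (1 - |a|²)(1 - |z|²)`
  rw [Complex.sq_norm, Complex.normSq_apply] at *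
  rw [Complex.sq_norm, Complex.normSq_apply]
  simp only [Complex.sub_re, Complex.sub_im, Complex.mul_re, Complex.mul_im, Complex.conj_re,
    Complex.conj_im, Complex.one_re, Complex.one_im]
  nlinarith [mul_pos (sub_pos.mpr ha2) (sub_pos.mpr hz2)]

theorem neg_mem_disc {a : ℂ} (ha : a ∈ disc) : -a ∈ disc := by
  rwa [mem_disc, norm_neg, ← mem_disc]

theorem moeb_neg_moeb {a z : ℂ} (ha : a ∈ disc) (hz : z ∈ disc) : moeb (-a) (moeb a z) = z := by
  have h1 := one_sub_conj_mul_ne_zero ha hz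
  have h2 := one_sub_conj_mul_ne_zero (neg_mem_disc ha) (moeb_mem_disc ha hz)
  have h3 : (1 - conj a * z) * moeb a z = z - a := mul_div_cancel₀ _ h1
  rw [moeb, div_eq_iff h2, map_neg, ← sub_eq_zero]
  refine (mul_eq_zero_iff_left h1).mp ?_
  linear_combination (1 - conj a * z) * h3

theorem differentiableOn_moeb {a : ℂ} (ha : a ∈ disc) : DifferentiableOn ℂ (moeb a) disc := by
  refine DifferentiableOn.div (by fun_prop) (by fun_prop) fun z hz => ?_
  exact one_sub_conj_mul_ne_zero ha hz

theorem isHolMap_moeb {a : ℂ} (ha : a ∈ disc) : IsHolMap disc disc (moeb a) :=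
  ⟨differentiableOn_moeb ha, fun _ hz => moeb_mem_disc ha hz⟩

theorem IsHolMap.comp {U V W : Set ℂ} {f g : ℂ → ℂ} (hg : IsHolMap V W g) (hf : IsHolMap U V f) :
    IsHolMap U W (g ∘ f) :=
  ⟨hg.1.comp hf.1 hf.2, hg.2.comp hf.2⟩

/-! ### The Schwarz lemma with its equality case -/

theorem IsHolMap.norm_le_of_map_zero {f : ℂ → ℂ} (hf : IsHolMap disc disc f) (h0 : f 0 = 0)
    {z : ℂ} (hz : z ∈ disc) : ‖f z‖ ≤ ‖z‖ :=
  Complex.norm_le_norm_of_mapsTo_ball hf.1 (fun _ hw => ball_subset_closedBall (hf.2 hw)) h0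
    (mem_disc.mp hz)

theorem IsHolMap.exists_rotation {f : ℂ → ℂ} (hf : IsHolMap disc disc f) (h0 : f 0 = 0)
    {z₀ : ℂ} (hz₀ : z₀ ∈ disc) (hne : z₀ ≠ 0) (heq : ‖f z₀‖ = ‖z₀‖) :
    ∃ c : ℂ, ‖c‖ = 1 ∧ ∀ z ∈ disc, f z = c * z := by
  obtain ⟨c, hc, h⟩ := Complex.affine_of_mapsTo_ball_of_exists_norm_dslope_eq_div'
    (f := f) (c := 0) (R₁ := 1) (R₂ := 1) hf.1
    (fun _ hw => by rw [h0]; exact ball_subset_closedBall (hf.2 hw))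
    ⟨z₀, hz₀, by
      rw [dslope_of_ne _ hne, slope_def_field, h0, sub_zero, sub_zero, norm_div, heq,
        div_self (norm_ne_zero_iff.mpr hne), div_one]⟩
  refine ⟨c, by simpa using hc, fun z hz => ?_⟩
  rw [h hz, h0]
  simp [mul_comm]

/-! ### Normal families and Hurwitz's theorem -/

/-- Montel's theorem, in ultrafilter form: by the Schwarz lemma a family of holomorphic maps into
the unit disc is locally equi-Lipschitz, so that its pointwise limit along an ultrafilter, which
exists by compactness of the closed disc, is attained locally uniformly. -/
theorem exists_tendstoLocallyUniformlyOn_of_isHolMap {ι : Type*} (U : Ultrafilter ι) {D : Set ℂ}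
    (hD : IsOpen D) {F : ι → ℂ → ℂ} (hF : ∀ i, IsHolMap D disc (F i)) :
    ∃ f : ℂ → ℂ, (∀ z ∈ D, f z ∈ closedBall (0 : ℂ) 1) ∧ TendstoLocallyUniformlyOn F f U D := by
  have key : ∀ z : ℂ, ∃ w : ℂ, z ∈ D → w ∈ closedBall (0 : ℂ) 1 ∧
      Tendsto (fun i => F i z) U (𝓝 w) := by
    intro z
    by_cases hz : z ∈ D
    · obtain ⟨w, hw, hle⟩ := (isCompact_closedBall (0 : ℂ) 1).ultrafilter_le_nhds
        (U.map fun i => F i z)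
        (le_principal_iff.mpr (Filter.mem_map.mpr (Eventually.of_forall fun i =>
          ball_subset_closedBall ((hF i).2 hz))))
      exact ⟨w, fun _ => ⟨hw, hle⟩⟩
    · exact ⟨0, fun h => absurd h hz⟩
  choose f hf using key
  refine ⟨f, fun z hz => (hf z hz).1, ?_⟩
  rw [Metric.tendstoLocallyUniformlyOn_iff]
  intro ε hε c hc
  obtain ⟨r, hr, hrD⟩ := Metric.isOpen_iff.mp hD c hc
  have lip : ∀ i, ∀ z ∈ ball c r, dist (F i z) (F i c) ≤ 2 / r * dist z c := by
    intro i z hz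
    refine Complex.dist_le_div_mul_dist_of_mapsTo_ball ((hF i).1.mono hrD) (fun w hw => ?_) hz
    have h1 := mem_disc.mp ((hF i).2 (hrD hw))
    have h2 := mem_disc.mp ((hF i).2 hc)
    rw [mem_closedBall, dist_eq_norm]
    linarith [norm_sub_le (F i w) (F i c)]
  have lip' : ∀ z ∈ ball c r, dist (f z) (f c) ≤ 2 / r * dist z c := fun z hz =>
    le_of_tendsto ((hf z (hrD hz)).2.dist (hf c hc).2) (Eventually.of_forall fun i => lip i z hz)
  refine ⟨ball c (min r (r * ε / 8)), mem_nhdsWithin_of_mem_nhds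
    (ball_mem_nhds _ (by positivity)), ?_⟩
  filter_upwards [(Metric.tendsto_nhds.mp (hf c hc).2) (ε / 2) (by positivity)] with i hi z hz
  rw [mem_ball, lt_min_iff] at hz
  have h1 := lip i z hz.1
  have h2 := lip' z hz.1
  have h3 : 2 / r * dist z c < ε / 4 := by
    rw [div_mul_eq_mul_div, div_lt_iff₀ hr]
    linarith [hz.2]
  have h4 := dist_triangle4 (f z) (f c) (F i c) (F i z)
  rw [dist_comm (f c) (F i c), dist_comm (F i c) (F i z)] at h4
  linarith

/-- Hurwitz's theorem: a zero of a locally uniform limit of zero-free holomorphic functions is not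
isolated. The minimum modulus principle on a small circle avoiding the zeros of the limit bounds
the approximating functions at the centre from below. -/
theorem ne_zero_of_tendstoLocallyUniformlyOn {ι : Type*} {l : Filter ι} [l.NeBot] {D : Set ℂ}
    (hD : IsOpen D) {F : ι → ℂ → ℂ} {f : ℂ → ℂ} (hF : ∀ i, DifferentiableOn ℂ (F i) D)
    (hF0 : ∀ i, ∀ z ∈ D, F i z ≠ 0) (hlim : TendstoLocallyUniformlyOn F f l D) {a : ℂ}
    (ha : a ∈ D) (hfa : ¬ ∀ᶠ z in 𝓝 a, f z = 0) : f a ≠ 0 := by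
  intro h0
  have hfd : DifferentiableOn ℂ f D := hlim.differentiableOn (Eventually.of_forall hF) hD
  have hne := (hfd.analyticAt
    (hD.mem_nhds ha)).eventually_eq_zero_or_eventually_ne_zero.resolve_left hfa
  rw [eventually_nhdsWithin_iff] at hne
  obtain ⟨R, hR, hRs⟩ := Metric.eventually_nhds_iff_ball.mp (hne.and (hD.mem_nhds ha))
  set r := R / 2 with hr
  have hr0 : 0 < r := by positivity
  have hrR : closedBall a r ⊆ ball a R := closedBall_subset_ball (by linarith)
  have hrD : closedBall a r ⊆ D := fun z hz => (hRs z (hrR hz)).2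
  have hsD : sphere a r ⊆ D := sphere_subset_closedBall.trans hrD
  -- the minimum `δ > 0` of `‖f‖` on the circle
  obtain ⟨z₁, hz₁, hmin⟩ := (isCompact_sphere a r).exists_isMinOn
    (NormedSpace.sphere_nonempty.mpr hr0.le) (hfd.continuousOn.mono hsD).norm
  set δ := ‖f z₁‖
  have hδ : 0 < δ := norm_pos_iff.mpr ((hRs z₁ (hrR (sphere_subset_closedBall hz₁))).1 (by
    intro h
    rw [mem_singleton_iff.mp h, mem_sphere, dist_self] at hz₁
    exact hr0.ne hz₁))
  have hunif : TendstoUniformlyOn F f l (sphere a r) :=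
    (tendstoLocallyUniformlyOn_iff_tendstoUniformlyOn_of_compact (isCompact_sphere a r)).mp
      (hlim.mono hsD)
  have hpt : Tendsto (fun i => F i a) l (𝓝 (f a)) := hlim.tendsto_at ha
  obtain ⟨i, hi1, hi2⟩ := ((Metric.tendstoUniformlyOn_iff.mp hunif (δ / 2) (by positivity)).and
    (Metric.tendsto_nhds.mp hpt (δ / 2) (by positivity))).exists
  rw [h0, dist_zero_right] at hi2
  have hdc : DiffContOnCl ℂ (fun z => (F i z)⁻¹) (ball a r) := by
    refine DifferentiableOn.diffContOnCl ?_
    rw [closure_ball a hr0.ne']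
    exact ((hF i).mono hrD).inv fun z hz => hF0 i z (hrD hz)
  have := Complex.norm_le_of_forall_mem_frontier_norm_le (C := (δ / 2)⁻¹) isBounded_ball hdc
    (fun z hz => by
      rw [frontier_ball a hr0.ne'] at hz
      have h1 := hi1 z hz
      have h2 : δ ≤ ‖f z‖ := hmin hz
      rw [dist_eq_norm] at h1
      have h3 := norm_sub_norm_le (f z) (F i z)
      rw [norm_inv]
      exact inv_anti₀ (by positivity) (by linarith))
    (subset_closure (mem_ball_self hr0))
  rw [norm_inv, inv_le_inv₀ (norm_pos_iff.mpr (hF0 i a ha)) (by positivity)] at this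
  linarith

/-! ### The Riemann mapping theorem -/

/-- The holomorphic immersions of `D` into the unit disc that are injective and send `p` to `0`;
the Riemann map is an extremal element of this family. -/
def schlichtFamily (D : Set ℂ) (p : ℂ) : Set (ℂ → ℂ) :=
  {f | IsHolMap D disc f ∧ InjOn f D ∧ (∀ z ∈ D, deriv f z ≠ 0) ∧ f p = 0}

/-- A holomorphic right factor of an injective immersion is an injective immersion. -/
theorem mem_schlichtFamily_of_comp {D : Set ℂ} (hD : IsOpen D) {p : ℂ} {f h Ψ : ℂ → ℂ}
    (hinj : InjOn f D) (hder : ∀ z ∈ D, deriv f z ≠ 0) (hh : IsHolMap D disc h)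
    (hΨ : ∀ z ∈ D, DifferentiableAt ℂ Ψ (h z)) (hfac : ∀ z ∈ D, f z = Ψ (h z)) (hp : h p = 0) :
    h ∈ schlichtFamily D p := by
  refine ⟨hh, fun z hz w hw hzw => hinj hz hw (by rw [hfac z hz, hfac w hw, hzw]),
    fun z hz h0 => hder z hz ?_, hp⟩
  have h1 : f =ᶠ[𝓝 z] Ψ ∘ h := by
    filter_upwards [hD.mem_nhds hz] with w hw using hfac w hw
  rw [h1.deriv_eq, deriv_comp z (hΨ z hz)
    (hh.1.differentiableAt (hD.mem_nhds hz)), h0, mul_zero]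

/-- A continuous square root of a zero-free holomorphic function is holomorphic. -/
theorem differentiableOn_of_sq_eq {D : Set ℂ} (hD : IsOpen D) {F g : ℂ → ℂ}
    (hF : DifferentiableOn ℂ F D) (hg : ContinuousOn g D) (hsq : ∀ z ∈ D, g z ^ 2 = F z)
    (hF0 : ∀ z ∈ D, F z ≠ 0) : DifferentiableOn ℂ g D := by
  intro a ha
  have hga : g a ≠ 0 := fun h => hF0 a ha (by rw [← hsq a ha, h]; simp)
  have hgc : ContinuousAt g a := hg.continuousAt (hD.mem_nhds ha)
  have hFd := (hF.differentiableAt (hD.mem_nhds ha)).hasDerivAt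
  have hsum : Tendsto (fun z => g z + g a) (𝓝[≠] a) (𝓝 (g a + g a)) :=
    (hgc.tendsto.mono_left nhdsWithin_le_nhds).add_const _
  have h2 : g a + g a ≠ 0 := by rw [← two_mul]; exact mul_ne_zero two_ne_zero hga
  have key : HasDerivAt g (deriv F a / (g a + g a)) a := by
    rw [hasDerivAt_iff_tendsto_slope] at hFd ⊢
    refine (hFd.div hsum h2).congr' ?_
    filter_upwards [hsum.eventually_ne h2, nhdsWithin_le_nhds (hD.mem_nhds ha),
      self_mem_nhdsWithin] with z hz hzD hza
    have hza' : z - a ≠ 0 := sub_ne_zero.mpr hza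
    simp only [Pi.div_apply, slope_def_field]
    rw [← hsq z hzD, ← hsq a ha]
    field_simp
    ring
  exact key.differentiableAt.differentiableWithinAt

/-- A branch of `√(z - a)`, with `a ∉ D`, never takes a value and its negative, so its values keep
away from some point, and inverting about that point maps `D` into the disc. -/
theorem schlichtFamily_nonempty {D : Set ℂ} (hD : IsOpen D) (hsc : IsSimplyConnected D)
    (hne : D ≠ univ) {p q : ℂ} (hp : p ∈ D) (hq : q ∈ D) (hpq : q ≠ p) :
    (schlichtFamily D p).Nonempty := by
  obtain ⟨a, ha⟩ := (ne_univ_iff_exists_notMem D).mp hne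
  have hF : DifferentiableOn ℂ (fun z => z - a) D := by fun_prop
  have hF0 : ∀ z ∈ D, z - a ≠ 0 := fun z hz => sub_ne_zero.mpr (ne_of_mem_of_not_mem hz ha)
  obtain ⟨g, hgc, hg2⟩ := Complex.exists_continuousOn_pow_eq hsc hD hF.continuousOn
    (by rintro ⟨z, hz, h⟩; exact hF0 z hz h) two_ne_zero
  have hgd : DifferentiableOn ℂ g D :=
    differentiableOn_of_sq_eq hD hF hgc (fun z _ => hg2 z) hF0
  have hinj : ∀ z w, g z ^ 2 = g w ^ 2 → z = w := fun z w h => by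
    rw [hg2, hg2] at h
    exact sub_left_injective h
  have hopen : IsOpen (g '' D) := by
    rcases (hgd.analyticOnNhd hD).is_constant_or_isOpen
      hsc.isPathConnected.isConnected.isPreconnected with ⟨c, hc⟩ | hop
    · exact absurd (hinj q p (by rw [hc q hq, hc p hp])) hpq
    · exact hop D Subset.rfl hD
  obtain ⟨ε, hε, hball⟩ := Metric.isOpen_iff.mp hopen (g p) ⟨p, hp, rfl⟩
  set c := g p
  have hfar : ∀ z ∈ D, ε ≤ ‖g z + c‖ := fun z hz => by
    by_contra! hlt
    obtain ⟨w, hw, hwz⟩ := hball (show -g z ∈ ball c ε by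
      rwa [mem_ball, dist_eq_norm, ← norm_neg, neg_sub, sub_neg_eq_add, add_comm])
    have h1 : w = z := hinj w z (by rw [hwz, neg_sq])
    rw [h1] at hwz
    exact hF0 z hz (by rw [← hg2, self_eq_neg.mp hwz]; simp)
  have hne0 : ∀ z ∈ D, g z + c ≠ 0 := fun z hz =>
    norm_pos_iff.mp (hε.trans_le (hfar z hz))
  have hε0 : (ε : ℂ) ≠ 0 := Complex.ofReal_ne_zero.mpr hε.ne'
  -- `ε / (g + c)` only lands in the closed disc, whence the factor `2`
  set h : ℂ → ℂ := fun z => ε / (2 * (g z + c)) with hdef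
  have hh : IsHolMap D disc h := by
    refine ⟨DifferentiableOn.div (by fun_prop) (by fun_prop) fun z hz =>
      mul_ne_zero two_ne_zero (hne0 z hz), fun z hz => ?_⟩
    rw [mem_disc, hdef, norm_div, norm_mul, Complex.norm_real, Real.norm_of_nonneg hε.le,
      RCLike.norm_ofNat, div_lt_one (by linarith [hfar z hz])]
    linarith [hfar z hz]
  have hh0 : ∀ z ∈ D, h z ≠ 0 := fun z hz =>
    div_ne_zero hε0 (mul_ne_zero two_ne_zero (hne0 z hz))
  have hb : h p ∈ disc := hh.2 hp
  have hback : ∀ z ∈ D, moeb (-h p) ((moeb (h p) ∘ h) z) = h z := fun z hz =>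
    moeb_neg_moeb hb (hh.2 hz)
  have hmh : IsHolMap D disc (moeb (h p) ∘ h) := (isHolMap_moeb hb).comp hh
  refine ⟨moeb (h p) ∘ h, mem_schlichtFamily_of_comp (f := id)
    (Ψ := fun u => (ε / (2 * moeb (-h p) u) - c) ^ 2 + a) hD (injOn_id D)
    (fun z _ => by simp) hmh (fun z hz => ?_) (fun z hz => ?_) (by simp)⟩
  · have h1 := (differentiableOn_moeb (neg_mem_disc hb)).differentiableAt
      (isOpen_disc.mem_nhds (hmh.2 hz))
    have h2 : 2 * moeb (-h p) ((moeb (h p) ∘ h) z) ≠ 0 := by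
      rw [hback z hz]
      exact mul_ne_zero two_ne_zero (hh0 z hz)
    have h3 : DifferentiableAt ℂ (fun u => (ε : ℂ) / (2 * moeb (-h p) u))
      ((moeb (h p) ∘ h) z) := (differentiableAt_const _).fun_div (h1.const_mul 2) h2
    exact ((h3.sub_const c).fun_pow 2).add_const a
  · have h1 : ε / (2 * h z) - c = g z := by
      have := hne0 z hz
      simp only [hdef]
      field_simp
      ring
    simp only [hback z hz, h1, hg2, id, sub_add_cancel]

/-- Koebe's square root trick: a member of the family that omits a point of the disc is the
composition of another member with a non-injective self-map of the disc fixing `0`, so by the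
Schwarz lemma the other member is larger in modulus away from `p`. -/
theorem exists_norm_lt_of_not_surjOn {D : Set ℂ} (hD : IsOpen D) (hsc : IsSimplyConnected D)
    {p q : ℂ} (hp : p ∈ D) (hq : q ∈ D) (hpq : q ≠ p) {f : ℂ → ℂ} (hf : f ∈ schlichtFamily D p)
    {w : ℂ} (hw : w ∈ disc) (hfw : ∀ z ∈ D, f z ≠ w) :
    ∃ h ∈ schlichtFamily D p, ‖f q‖ < ‖h q‖ := by
  obtain ⟨hfh, hinj, hder, hfp⟩ := hf
  have hFh : IsHolMap D disc (moeb w ∘ f) := (isHolMap_moeb hw).comp hfh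
  have hF0 : ∀ z ∈ D, (moeb w ∘ f) z ≠ 0 := fun z hz =>
    (moeb_eq_zero_iff hw (hfh.2 hz)).not.mpr (hfw z hz)
  obtain ⟨g, hgc, hg2⟩ := Complex.exists_continuousOn_pow_eq hsc hD hFh.1.continuousOn
    (by rintro ⟨z, hz, h⟩; exact hF0 z hz h) two_ne_zero
  have hgh : IsHolMap D disc g := by
    refine ⟨differentiableOn_of_sq_eq hD hFh.1 hgc (fun z _ => hg2 z) hF0, fun z hz => ?_⟩
    have h1 := mem_disc.mp (hFh.2 hz)
    rw [← hg2, norm_pow] at h1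
    exact mem_disc.mpr (by nlinarith [norm_nonneg (g z)])
  set b := g p with hb
  have hbd : b ∈ disc := hgh.2 hp
  have hb2 : b ^ 2 = -w := by rw [hb, hg2]; simp [hfp]
  have hhh : IsHolMap D disc (moeb b ∘ g) := (isHolMap_moeb hbd).comp hgh
  have hsq : IsHolMap disc disc (fun z => z ^ 2) := by
    refine ⟨by fun_prop, fun z hz => ?_⟩
    rw [mem_disc] at *
    rw [norm_pow]
    nlinarith [norm_nonneg z]
  have hnb := neg_mem_disc hbd
  have hnw := neg_mem_disc hw
  set Ψ : ℂ → ℂ := moeb (-w) ∘ (fun z => z ^ 2) ∘ moeb (-b) with hΨdef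
  have hΨ : IsHolMap disc disc Ψ :=
    (isHolMap_moeb hnw).comp (hsq.comp (isHolMap_moeb hnb))
  have hfac : ∀ z ∈ D, f z = Ψ ((moeb b ∘ g) z) := fun z hz => by
    simp only [hΨdef, Function.comp_apply]
    rw [moeb_neg_moeb hbd (hgh.2 hz), hg2]
    exact (moeb_neg_moeb hw (hfh.2 hz)).symm
  have hmem := mem_schlichtFamily_of_comp (p := p) hD hinj hder hhh
    (fun z hz => hΨ.1.differentiableAt (isOpen_disc.mem_nhds (hhh.2 hz))) hfac (by simp [← hb])
  refine ⟨_, hmem, ?_⟩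
  have hΨ0 : Ψ 0 = 0 := by simp [hΨdef, hb2]
  have hhq := hhh.2 hq
  rw [hfac q hq]
  refine lt_of_le_of_ne (hΨ.norm_le_of_map_zero hΨ0 hhq) fun heq => ?_
  have hhq0 : (moeb b ∘ g) q ≠ 0 := fun h0 =>
    hpq (hmem.2.1 hq hp (by rw [h0, hmem.2.2.2]))
  obtain ⟨c, hc, hrot⟩ := hΨ.exists_rotation hΨ0 hhq hhq0 heq
  -- `Ψ` takes the same value at the images of `1/2` and `-1/2`, so it is not a rotation
  have hhalf : (1 / 2 : ℂ) ∈ disc := by rw [mem_disc]; norm_num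
  have h1 := moeb_mem_disc hbd hhalf
  have h2 := moeb_mem_disc hbd (neg_mem_disc hhalf)
  have h3 : Ψ (moeb b (1 / 2)) = Ψ (moeb b (-(1 / 2))) := by
    simp only [hΨdef, Function.comp_apply]
    rw [moeb_neg_moeb hbd hhalf, moeb_neg_moeb hbd (neg_mem_disc hhalf), neg_sq]
  rw [hrot _ h1, hrot _ h2] at h3
  have hc0 : c ≠ 0 := by rintro rfl; simp at hc
  have h4 := congrArg (moeb (-b)) (mul_left_cancel₀ hc0 h3)
  rw [moeb_neg_moeb hbd hhalf, moeb_neg_moeb hbd (neg_mem_disc hhalf)] at h4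
  norm_num at h4

/-- The modulus at `q ≠ p` is maximised in the family: a limit of a maximising sequence is
holomorphic, and it stays injective, immersive and disc-valued by Hurwitz's theorem and the
open mapping theorem. -/
theorem exists_isMax_schlichtFamily {D : Set ℂ} (hD : IsOpen D) (hsc : IsSimplyConnected D)
    (hne : D ≠ univ) {p q : ℂ} (hp : p ∈ D) (hq : q ∈ D) (hpq : q ≠ p) :
    ∃ f ∈ schlichtFamily D p, ∀ h ∈ schlichtFamily D p, ‖h q‖ ≤ ‖f q‖ := by
  have hpre : IsPreconnected D := hsc.isPathConnected.isConnected.isPreconnected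
  set S : Set ℝ := (fun f : ℂ → ℂ => ‖f q‖) '' schlichtFamily D p
  have hSne : S.Nonempty := (schlichtFamily_nonempty hD hsc hne hp hq hpq).image _
  have hSb : BddAbove S := ⟨1, by rintro _ ⟨f, hf, rfl⟩; exact (mem_disc.mp (hf.1.2 hq)).le⟩
  obtain ⟨u, -, hu, huS⟩ := exists_seq_tendsto_sSup hSne hSb
  choose F hF hFu using huS
  set U := Filter.hyperfilter ℕ
  obtain ⟨f, hf1, hlim⟩ := exists_tendstoLocallyUniformlyOn_of_isHolMap U hD fun i => (hF i).1
  have hfd : DifferentiableOn ℂ f D :=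
    hlim.differentiableOn (Eventually.of_forall fun i => (hF i).1.1) hD
  have hfan : AnalyticOnNhd ℂ f D := hfd.analyticOnNhd hD
  have hfp : f p = 0 := by
    have h1 := hlim.tendsto_at hp
    have h2 : (fun i => F i p) = fun _ => 0 := funext fun i => (hF i).2.2.2
    rw [h2] at h1
    exact (tendsto_nhds_unique h1 tendsto_const_nhds)
  have hfq : ‖f q‖ = sSup S := by
    refine tendsto_nhds_unique (hlim.tendsto_at hq).norm ?_
    have h2 : (fun i => ‖F i q‖) = u := funext hFu
    rw [h2]
    refine hu.mono_left ?_
    rw [← Nat.cofinite_eq_atTop]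
    exact Filter.hyperfilter_le_cofinite
  have hmax : ∀ h ∈ schlichtFamily D p, ‖h q‖ ≤ ‖f q‖ := fun h hh => by
    rw [hfq]; exact le_csSup hSb ⟨h, hh, rfl⟩
  have hfq0 : f q ≠ 0 := by
    obtain ⟨h, hh⟩ := schlichtFamily_nonempty hD hsc hne hp hq hpq
    intro h0
    have h1 := hmax h hh
    rw [h0, norm_zero, norm_le_zero_iff, ← hh.2.2.2] at h1
    exact hpq (hh.2.1 hq hp h1)
  have hnc : ∀ a ∈ D, ∀ c : ℂ, ¬ ∀ᶠ z in 𝓝 a, f z = c := by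
    intro a ha c hc
    have h1 := hfan.eqOn_of_preconnected_of_eventuallyEq (analyticOnNhd_const (v := c)) hpre ha hc
    exact hfq0 (by rw [h1 hq, ← h1 hp, hfp])
  refine ⟨f, ⟨⟨hfd, fun z hz => ?_⟩, fun a ha b hb hab => ?_, fun a ha => ?_, hfp⟩, hmax⟩
  · rcases hfan.is_constant_or_isOpen hpre with ⟨c, hc⟩ | hop
    · exact absurd (by rw [hc q hq, ← hc p hp, hfp]) hfq0
    · have hsub : f '' D ⊆ closedBall 0 1 := by rintro _ ⟨z, hz, rfl⟩; exact hf1 z hz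
      have := interior_maximal hsub (hop D Subset.rfl hD) ⟨z, hz, rfl⟩
      rwa [interior_closedBall _ one_ne_zero] at this
  · by_contra hne
    have hD' : IsOpen (D \ {b}) := hD.sdiff isClosed_singleton
    have hlim' : TendstoLocallyUniformlyOn (fun i z => F i z - F i b) (fun z => f z - f b) U
        (D \ {b}) :=
      (hlim.mono sdiff_subset).sub
        ((hlim.tendsto_at hb).tendstoUniformlyOn_const _).tendstoLocallyUniformlyOn
    refine ne_zero_of_tendstoLocallyUniformlyOn hD'
      (fun i => ((hF i).1.1.mono sdiff_subset).sub_const _) (fun i z hz h0 => ?_) hlim'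
      (a := a) ⟨ha, hne⟩ (fun h => hnc a ha (f b) (h.mono fun z hz => sub_eq_zero.mp hz))
      (sub_eq_zero.mpr hab)
    exact hz.2 ((hF i).2.1 hz.1 hb (sub_eq_zero.mp h0))
  · refine ne_zero_of_tendstoLocallyUniformlyOn hD
      (fun i => (hF i).1.1.deriv hD) (fun i z hz => (hF i).2.2.1 z hz)
      (hlim.deriv (Eventually.of_forall fun i => (hF i).1.1) hD) ha fun h => ?_
    have h1 := (hfan.deriv).eqOn_of_preconnected_of_eventuallyEq
      (analyticOnNhd_const (v := (0 : ℂ))) hpre ha h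
    exact hfq0 ((hD.is_const_of_deriv_eq_zero hpre hfd h1 hq hp).trans hfp)

theorem isBiholomorphic_of_bijOn {U V : Set ℂ} (hU : IsOpen U) {f : ℂ → ℂ} (hf : IsHolMap U V f)
    (hinj : InjOn f U) (hder : ∀ z ∈ U, deriv f z ≠ 0) (hsurj : SurjOn f U V) :
    IsBiholomorphic U V f := by
  refine ⟨hf, Function.invFunOn f U, ⟨?_, hsurj.mapsTo_invFunOn⟩,
    hinj.leftInvOn_invFunOn, hsurj.rightInvOn_invFunOn⟩
  intro w hw
  obtain ⟨z, hz, rfl⟩ := hsurj hw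
  have hs : HasStrictDerivAt f (deriv f z) z :=
    (hf.1.analyticAt (hU.mem_nhds hz)).hasStrictDerivAt
  exact (hs.to_local_left_inverse (hder z hz) (by
    filter_upwards [hU.mem_nhds hz] with x hx using
      hinj.leftInvOn_invFunOn hx)).hasDerivAt.differentiableAt.differentiableWithinAt

/-- The Riemann mapping theorem. -/
theorem exists_isBiholomorphic_disc {D : Set ℂ} (hD : IsOpen D) (hsc : IsSimplyConnected D)
    (hne : D ≠ univ) {p q : ℂ} (hp : p ∈ D) (hq : q ∈ D) (hpq : q ≠ p) :
    ∃ φ : ℂ → ℂ, IsBiholomorphic D disc φ ∧ φ p = 0 := by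
  obtain ⟨f, hf, hmax⟩ := exists_isMax_schlichtFamily hD hsc hne hp hq hpq
  refine ⟨f, isBiholomorphic_of_bijOn hD hf.1 hf.2.1 hf.2.2.1 fun w hw => ?_, hf.2.2.2⟩
  by_contra hnot
  obtain ⟨h, hh, hlt⟩ := exists_norm_lt_of_not_surjOn hD hsc hp hq hpq hf hw
    fun z hz hzw => hnot ⟨z, hz, hzw⟩
  exact absurd (hmax h hh) (not_le.mpr hlt)

/-! ### The normalized Riemann map -/

theorem isHolMap_mul_left {c : ℂ} (hc : ‖c‖ = 1) : IsHolMap disc disc (c * ·) := by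
  refine ⟨by fun_prop, fun z hz => ?_⟩
  rw [mem_disc] at *
  rwa [norm_mul, hc, one_mul]

/-- Two biholomorphic maps onto the disc with a common zero differ by a rotation, so they agree as
soon as both are positive at one point. -/
theorem eqOn_of_isBiholomorphic_disc {D : Set ℂ} {φ ψ : ℂ → ℂ} (hφ : IsBiholomorphic D disc φ)
    (hψ : IsBiholomorphic D disc ψ) {p q : ℂ} (hp : p ∈ D) (hq : q ∈ D) (hφp : φ p = 0)
    (hψp : ψ p = 0) {s t : ℝ} (hs : 0 < s) (ht : 0 < t) (hφq : φ q = s) (hψq : ψ q = t) :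
    EqOn φ ψ D := by
  obtain ⟨hφh, φi, hφi, hφl, hφr⟩ := hφ
  obtain ⟨hψh, ψi, hψi, hψl, hψr⟩ := hψ
  have h1 : IsHolMap disc disc (ψ ∘ φi) := hψh.comp hφi
  have h2 : IsHolMap disc disc (φ ∘ ψi) := hφh.comp hψi
  have h10 : (ψ ∘ φi) 0 = 0 := by
    rw [Function.comp_apply, ← hφp, hφl hp, hψp, hφp]
  have h20 : (φ ∘ ψi) 0 = 0 := by
    rw [Function.comp_apply, ← hψp, hψl hp, hφp, hψp]
  have e1 : (ψ ∘ φi) (φ q) = ψ q := by rw [Function.comp_apply, hφl hq]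
  have e2 : (φ ∘ ψi) (ψ q) = φ q := by rw [Function.comp_apply, hψl hq]
  have n1 := h1.norm_le_of_map_zero h10 (hφh.2 hq)
  have n2 := h2.norm_le_of_map_zero h20 (hψh.2 hq)
  rw [e1] at n1
  rw [e2] at n2
  obtain ⟨c, hc, hrot⟩ := h1.exists_rotation h10 (hφh.2 hq)
    (by rw [hφq]; exact Complex.ofReal_ne_zero.mpr hs.ne') (by rw [e1]; exact le_antisymm n1 n2)
  have hst : s = t := by
    have := le_antisymm n2 n1
    rwa [hφq, hψq, Complex.norm_real, Complex.norm_real, Real.norm_of_nonneg hs.le,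
      Real.norm_of_nonneg ht.le] at this
  have hc1 : c = 1 := by
    have h3 := hrot (φ q) (hφh.2 hq)
    rw [e1, hφq, hψq, ← hst] at h3
    exact (mul_eq_right₀ (Complex.ofReal_ne_zero.mpr hs.ne')).mp h3.symm
  intro z hz
  have h3 := hrot (φ z) (hφh.2 hz)
  rw [Function.comp_apply, hφl hz, hc1, one_mul] at h3
  exact h3.symm

theorem IsBiholomorphic.injOn {U V : Set ℂ} {φ : ℂ → ℂ} (hφ : IsBiholomorphic U V φ) :
    InjOn φ U := by
  obtain ⟨-, _, -, h, -⟩ := hφ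
  exact h.injOn

theorem IsNormalizedRiemannMap.exists_pos {D : Set ℂ} {φ : ℂ → ℂ}
    (hφ : IsNormalizedRiemannMap D φ) (h0 : (0 : ℂ) ∈ D) (h1 : (1 : ℂ) ∈ D) :
    ∃ t : ℝ, 0 < t ∧ φ 1 = t := by
  obtain ⟨t, ht, h⟩ := hφ.2.2 1 ⟨zero_le_one, le_rfl⟩
  rw [Complex.ofReal_one] at h
  refine ⟨t, lt_of_le_of_ne ht.1 fun h' => ?_, h⟩
  rw [← h', Complex.ofReal_zero, ← hφ.2.1] at h
  exact one_ne_zero (hφ.1.injOn h1 h0 h)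

theorem IsHolMap.conj_conj {U V : Set ℂ} (hU : IsOpen U) (hUs : ∀ z, z ∈ U ↔ conj z ∈ U)
    (hVs : ∀ z, z ∈ V ↔ conj z ∈ V) {f : ℂ → ℂ} (hf : IsHolMap U V f) :
    IsHolMap U V (conj ∘ f ∘ conj) := by
  refine ⟨fun z hz => ?_, fun z hz => (hVs _).mp (hf.2 ((hUs z).mp hz))⟩
  have h := (hf.1.differentiableAt (hU.mem_nhds ((hUs z).mp hz))).conj_conj
  rw [Complex.conj_conj] at h
  exact h.differentiableWithinAt

theorem IsBiholomorphic.conj_conj {U V : Set ℂ} (hU : IsOpen U) (hV : IsOpen V)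
    (hUs : ∀ z, z ∈ U ↔ conj z ∈ U) (hVs : ∀ z, z ∈ V ↔ conj z ∈ V) {f : ℂ → ℂ}
    (hf : IsBiholomorphic U V f) : IsBiholomorphic U V (conj ∘ f ∘ conj) := by
  obtain ⟨hf, g, hg, hl, hr⟩ := hf
  refine ⟨hf.conj_conj hU hUs hVs, conj ∘ g ∘ conj, hg.conj_conj hV hVs hUs, fun z hz => ?_,
    fun z hz => ?_⟩
  · simp [hl ((hUs z).mp hz)]
  · simp [hr ((hVs z).mp hz)]

theorem disc_symm (z : ℂ) : z ∈ disc ↔ conj z ∈ disc := by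
  rw [mem_disc, mem_disc, RCLike.norm_conj]

/-- On a symmetric domain the Riemann map that vanishes at `0` and is positive at `1` commutes with
conjugation, by uniqueness. -/
theorem im_eq_zero_of_isBiholomorphic_disc {D : Set ℂ} (hD : IsOpen D)
    (hDs : ∀ z, z ∈ D ↔ conj z ∈ D) (h0 : (0 : ℂ) ∈ D) (h1 : (1 : ℂ) ∈ D) {φ : ℂ → ℂ}
    (hφ : IsBiholomorphic D disc φ) (hφ0 : φ 0 = 0) {s : ℝ} (hs : 0 < s) (hφ1 : φ 1 = s) {t : ℝ}
    (ht : (t : ℂ) ∈ D) : (φ t).im = 0 := by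
  have h := eqOn_of_isBiholomorphic_disc hφ (hφ.conj_conj hD isOpen_disc hDs disc_symm) h0 h1 hφ0
    (by simp [hφ0]) hs hs hφ1 (by simp [hφ1]) ht
  simp only [Function.comp_apply, Complex.conj_ofReal] at h
  exact Complex.conj_eq_iff_im.mp h.symm

/-- The Riemann map rotated to be positive at `1` is nonnegative on `[0, 1]`: it is real there, and
by injectivity it has no second zero. -/
theorem exists_isNormalizedRiemannMap {D : Set ℂ} (hD : IsOpen D) (hsc : IsSimplyConnected D)
    (hne : D ≠ univ) (hDs : ∀ z, z ∈ D ↔ conj z ∈ D) (hI : ∀ t ∈ Icc (0 : ℝ) 1, (t : ℂ) ∈ D) :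
    ∃ φ, IsNormalizedRiemannMap D φ := by
  have h0 : (0 : ℂ) ∈ D := by simpa using hI 0 ⟨le_rfl, zero_le_one⟩
  have h1 : (1 : ℂ) ∈ D := by simpa using hI 1 ⟨zero_le_one, le_rfl⟩
  obtain ⟨f, hf, hf0⟩ := exists_isBiholomorphic_disc hD hsc hne h0 h1 one_ne_zero
  have hf1 : f 1 ≠ 0 := fun h => one_ne_zero (hf.injOn h1 h0 (h.trans hf0.symm))
  have hn : 0 < ‖f 1‖ := norm_pos_iff.mpr hf1
  have hn' : (‖f 1‖ : ℂ) ≠ 0 := Complex.ofReal_ne_zero.mpr hn.ne'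
  -- the rotation that makes the value at `1` positive
  set c : ℂ := ‖f 1‖ / f 1 with hc
  have hcn : ‖c‖ = 1 := by rw [hc, norm_div, Complex.norm_real, norm_norm, div_self hn.ne']
  have hc0 : c ≠ 0 := div_ne_zero hn' hf1
  have hφ : IsBiholomorphic D disc ((c * ·) ∘ f) := by
    obtain ⟨hfh, g, hg, hl, hr⟩ := hf
    have hci : IsHolMap disc disc (c⁻¹ * ·) := isHolMap_mul_left (by rw [norm_inv, hcn, inv_one])
    refine ⟨(isHolMap_mul_left hcn).comp hfh, g ∘ (c⁻¹ * ·), hg.comp hci, fun z hz => ?_,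
      fun z hz => ?_⟩
    · simp [hc0, hl hz]
    · have h2 : f (g (c⁻¹ * z)) = c⁻¹ * z := hr (hci.2 hz)
      simp [h2, hc0]
  have hφ0 : ((c * ·) ∘ f) 0 = 0 := by simp [hf0]
  have hφ1 : ((c * ·) ∘ f) 1 = (‖f 1‖ : ℝ) := by simp [hc, hf1]
  set φ := (c * ·) ∘ f
  refine ⟨φ, hφ, hφ0, fun x hx => ?_⟩
  have him : ∀ t ∈ Icc (0 : ℝ) 1, φ t = ((φ t).re : ℂ) := fun t ht =>
    Complex.ext (by simp) (by
      simpa using im_eq_zero_of_isBiholomorphic_disc hD hDs h0 h1 hφ hφ0 hn hφ1 (hI t ht))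
  have hcont : ContinuousOn (fun t : ℝ => (φ t).re) (Icc 0 1) :=
    Complex.continuous_re.comp_continuousOn
      (hφ.1.1.continuousOn.comp Complex.continuous_ofReal.continuousOn hI)
  refine ⟨(φ x).re, ⟨?_, ?_⟩, him x hx⟩
  · by_contra! hneg
    -- a negative value at `x` would force a second zero of `φ` between `x` and `1`
    have hre1 : 0 ≤ (φ ((1 : ℝ) : ℂ)).re := by
      rw [Complex.ofReal_one, hφ1, Complex.ofReal_re]
      exact hn.le
    obtain ⟨y, hy, hy0⟩ := intermediate_value_Icc hx.2
      (hcont.mono (Icc_subset_Icc_left hx.1)) ⟨hneg.le, hre1⟩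
    have hyI : y ∈ Icc (0 : ℝ) 1 := ⟨hx.1.trans hy.1, hy.2⟩
    have h3 : φ y = φ 0 := by
      rw [him y hyI, hφ0]
      exact_mod_cast hy0
    have h4 : y = 0 := by exact_mod_cast hφ.injOn (hI y hyI) h0 h3
    have h5 : x = 0 := le_antisymm (h4 ▸ hy.1) hx.1
    rw [h5, Complex.ofReal_zero, hφ0, Complex.zero_re] at hneg
    exact hneg.false
  · exact (Complex.re_le_norm _).trans_lt (mem_disc.mp (hφ.1.2 (hI x hx)))

theorem IsNormalizedRiemannMap.eqOn {D : Set ℂ} (h0 : (0 : ℂ) ∈ D) (h1 : (1 : ℂ) ∈ D)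
    {φ ψ : ℂ → ℂ} (hφ : IsNormalizedRiemannMap D φ) (hψ : IsNormalizedRiemannMap D ψ) :
    EqOn φ ψ D := by
  obtain ⟨s, hs, hs1⟩ := hφ.exists_pos h0 h1
  obtain ⟨t, ht, ht1⟩ := hψ.exists_pos h0 h1
  exact eqOn_of_isBiholomorphic_disc hφ.1 hψ.1 h0 h1 hφ.2.1 hψ.2.1 hs ht hs1 ht1

theorem IsNormalizedRiemannMap.im_eq_zero {D : Set ℂ} (hD : IsOpen D)
    (hDs : ∀ z, z ∈ D ↔ conj z ∈ D) (h0 : (0 : ℂ) ∈ D) (h1 : (1 : ℂ) ∈ D) {φ : ℂ → ℂ}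
    (hφ : IsNormalizedRiemannMap D φ) {t : ℝ} (ht : (t : ℂ) ∈ D) : (φ t).im = 0 := by
  obtain ⟨s, hs, hs1⟩ := hφ.exists_pos h0 h1
  exact im_eq_zero_of_isBiholomorphic_disc hD hDs h0 h1 hφ.1 hφ.2.1 hs hs1 ht

/-! ### The Carathéodory distance of a domain biholomorphic to the disc -/

theorem norm_moeb (a z : ℂ) : ‖moeb a z‖ = moebiusDist a z := by
  rw [moeb, moebiusDist, norm_div, norm_div, norm_sub_rev]

theorem moebiusDist_comm (w z : ℂ) : moebiusDist w z = moebiusDist z w := by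
  rw [moebiusDist, moebiusDist, norm_div, norm_div, norm_sub_rev]
  congr 1
  rw [← RCLike.norm_conj]
  simp [mul_comm]

theorem moebiusDist_mem_Ioo {w z : ℂ} (hw : w ∈ disc) (hz : z ∈ disc) :
    moebiusDist w z ∈ Ioo (-1 : ℝ) 1 := by
  rw [← norm_moeb]
  exact ⟨neg_one_lt_zero.trans_le (norm_nonneg _), mem_disc.mp (moeb_mem_disc hw hz)⟩

theorem poincareDist_eq_artanh {w z : ℂ} (hw : w ∈ disc) (hz : z ∈ disc) :
    poincareDist w z = Real.artanh (moebiusDist w z) :=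
  (Real.artanh_eq_half_log (Ioo_subset_Icc_self (moebiusDist_mem_Ioo hw hz))).symm

/-- The Schwarz–Pick lemma. -/
theorem IsHolMap.moebiusDist_le {f : ℂ → ℂ} (hf : IsHolMap disc disc f) {w z : ℂ} (hw : w ∈ disc)
    (hz : z ∈ disc) : moebiusDist (f w) (f z) ≤ moebiusDist w z := by
  have hH : IsHolMap disc disc (moeb (f w) ∘ f ∘ moeb (-w)) :=
    (isHolMap_moeb (hf.2 hw)).comp (hf.comp (isHolMap_moeb (neg_mem_disc hw)))
  have h := hH.norm_le_of_map_zero (by simp) (moeb_mem_disc hw hz)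
  simp only [Function.comp_apply] at h
  rwa [moeb_neg_moeb hw hz, norm_moeb, norm_moeb] at h

theorem caratheodoryStar_eq_moebiusDist {D : Set ℂ} {φ : ℂ → ℂ} (hφ : IsBiholomorphic D disc φ)
    {w z : ℂ} (hw : w ∈ D) (hz : z ∈ D) :
    caratheodoryStar D w z = moebiusDist (φ w) (φ z) := by
  have hφh := hφ.1
  obtain ⟨-, ψ, hψ, hl, -⟩ := hφ
  have hgr : IsGreatest {t : ℝ | ∃ F : ℂ → ℂ, IsHolMap D disc F ∧ t = poincareDist (F w) (F z)}
      (poincareDist (φ w) (φ z)) := by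
    refine ⟨⟨φ, hφh, rfl⟩, ?_⟩
    rintro _ ⟨F, hF, rfl⟩
    rw [poincareDist_eq_artanh (hF.2 hw) (hF.2 hz),
      poincareDist_eq_artanh (hφh.2 hw) (hφh.2 hz),
      Real.artanh_le_artanh_iff (moebiusDist_mem_Ioo (hF.2 hw) (hF.2 hz))
        (moebiusDist_mem_Ioo (hφh.2 hw) (hφh.2 hz))]
    have h := (hF.comp hψ).moebiusDist_le (hφh.2 hw) (hφh.2 hz)
    simp only [Function.comp_apply] at h
    rwa [hl hw, hl hz] at h
  rw [caratheodoryStar, caratheodoryDist, hgr.csSup_eq,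
    poincareDist_eq_artanh (hφh.2 hw) (hφh.2 hz),
    Real.tanh_artanh (moebiusDist_mem_Ioo (hφh.2 hw) (hφh.2 hz))]

/-! ### Division by Blaschke factors -/

theorem deriv_ne_zero_of_eventually_leftInverse {f g : ℂ → ℂ} {a : ℂ} (hf : DifferentiableAt ℂ f a)
    (hg : DifferentiableAt ℂ g (f a)) (h : ∀ᶠ z in 𝓝 a, g (f z) = z) : deriv f a ≠ 0 := by
  intro h0
  have h1 : deriv (g ∘ f) a = 1 := by
    rw [EventuallyEq.deriv_eq (show g ∘ f =ᶠ[𝓝 a] id from h), deriv_id]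
  rw [deriv_comp a hg hf, h0, mul_zero] at h1
  exact zero_ne_one h1

theorem analyticAt_moeb {a z : ℂ} (ha : a ∈ disc) (hz : z ∈ disc) : AnalyticAt ℂ (moeb a) z :=
  (differentiableOn_moeb ha).analyticAt (isOpen_disc.mem_nhds hz)

theorem analyticOrderAt_moeb_self {a : ℂ} (ha : a ∈ disc) : analyticOrderAt (moeb a) a = 1 := by
  refine (analyticAt_moeb ha ha).analyticOrderAt_eq_one_of_zero_deriv_ne_zero (moeb_self a) ?_
  refine deriv_ne_zero_of_eventually_leftInverse (g := moeb (-a))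
    (analyticAt_moeb ha ha).differentiableAt
    (analyticAt_moeb (neg_mem_disc ha) (moeb_mem_disc ha ha)).differentiableAt ?_
  filter_upwards [isOpen_disc.mem_nhds ha] with z hz using moeb_neg_moeb ha hz

theorem analyticOrderAt_moeb_of_ne {a z : ℂ} (ha : a ∈ disc) (hz : z ∈ disc) (hne : z ≠ a) :
    analyticOrderAt (moeb a) z = 0 :=
  analyticOrderAt_eq_zero.mpr (Or.inr ((moeb_eq_zero_iff ha hz).not.mpr hne))

/-- Dividing a holomorphic map into the closed disc by the Blaschke factor of one of its zeros gives
a map into the closed disc, by the Schwarz lemma. -/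
theorem exists_eq_moeb_mul {h : ℂ → ℂ} (hh : IsHolMap disc (closedBall 0 1) h) {a : ℂ}
    (ha : a ∈ disc) (h0 : h a = 0) :
    ∃ u : ℂ → ℂ, IsHolMap disc (closedBall 0 1) u ∧ ∀ z ∈ disc, h z = moeb a z * u z := by
  have hnhds := isOpen_disc.mem_nhds ha
  set u : ℂ → ℂ := fun z => dslope h a z * (1 - conj a * z) with hu
  have hud : DifferentiableOn ℂ u disc :=
    ((Complex.differentiableOn_dslope hnhds).mpr hh.1).mul (by fun_prop)
  have hfac : ∀ z ∈ disc, h z = moeb a z * u z := fun z hz => by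
    have h1 := sub_smul_dslope h a z
    rw [h0, sub_zero, smul_eq_mul] at h1
    rw [hu, moeb, ← h1, div_mul_eq_mul_div, eq_div_iff (one_sub_conj_mul_ne_zero ha hz), mul_assoc]
  have hschwarz : ∀ z ∈ disc, ‖h z‖ ≤ ‖moeb a z‖ := fun z hz => by
    have hm := isHolMap_moeb (neg_mem_disc ha)
    have h1 := Complex.norm_le_norm_of_mapsTo_ball (f := h ∘ moeb (-a)) (R := 1)
      (hh.1.comp hm.1 hm.2) (hh.2.comp hm.2) (by simp [h0]) (mem_disc.mp (moeb_mem_disc ha hz))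
    rwa [Function.comp_apply, moeb_neg_moeb ha hz] at h1
  have hne : ∀ z ∈ disc, z ≠ a → ‖u z‖ ≤ 1 := fun z hz hza => by
    have h1 := hschwarz z hz
    rw [hfac z hz, norm_mul] at h1
    exact (mul_le_iff_le_one_right
      (norm_pos_iff.mpr ((moeb_eq_zero_iff ha hz).not.mpr hza))).mp h1
  refine ⟨u, ⟨hud, fun z hz => mem_closedBall_zero_iff.mpr ?_⟩, hfac⟩
  rcases eq_or_ne z a with rfl | hza
  · refine le_of_tendsto (((hud.continuousOn.continuousAt hnhds).norm.tendsto).mono_left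
      (nhdsWithin_le_nhds (s := {z}ᶜ))) ?_
    filter_upwards [nhdsWithin_le_nhds hnhds, self_mem_nhdsWithin] with w hw hwz using hne w hw hwz
  · exact hne z hz hza

theorem IsHolMap.analyticAt {U V : Set ℂ} {f : ℂ → ℂ} (hf : IsHolMap U V f) (hU : IsOpen U) {z : ℂ}
    (hz : z ∈ U) : AnalyticAt ℂ f z :=
  hf.1.analyticAt (hU.mem_nhds hz)

theorem exists_eq_moeb_pow_mul {h : ℂ → ℂ} (hh : IsHolMap disc (closedBall 0 1) h) {a : ℂ}
    (ha : a ∈ disc) (m : ℕ) (hm : (m : ℕ∞) ≤ analyticOrderAt h a) :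
    ∃ u : ℂ → ℂ, IsHolMap disc (closedBall 0 1) u ∧ (∀ z ∈ disc, h z = moeb a z ^ m * u z) ∧
      ∀ z ∈ disc, z ≠ a → analyticOrderAt u z = analyticOrderAt h z := by
  induction m generalizing h with
  | zero => exact ⟨h, hh, fun z _ => by simp, fun z _ _ => rfl⟩
  | succ m ih =>
    have h0 : h a = 0 := apply_eq_zero_of_analyticOrderAt_ne_zero fun h0 => by
      rw [h0] at hm
      exact absurd hm (by simp)
    obtain ⟨v, hv, hfac⟩ := exists_eq_moeb_mul hh ha h0
    have hord : ∀ z ∈ disc, analyticOrderAt h z = analyticOrderAt (moeb a) z +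
        analyticOrderAt v z := fun z hz => by
      rw [← analyticOrderAt_mul (analyticAt_moeb ha hz) (hv.analyticAt isOpen_disc hz)]
      refine analyticOrderAt_congr ?_
      filter_upwards [isOpen_disc.mem_nhds hz] with w hw using hfac w hw
    obtain ⟨u, hu, hufac, huord⟩ := ih hv (by
      rw [hord a ha, analyticOrderAt_moeb_self ha, add_comm, Nat.cast_add, Nat.cast_one] at hm
      exact (ENat.add_le_add_iff_left ENat.one_ne_top).mp hm)
    refine ⟨u, hu, fun z hz => by rw [hfac z hz, hufac z hz]; ring, fun z hz hza => ?_⟩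
    rw [huord z hz hza, hord z hz, analyticOrderAt_moeb_of_ne ha hz hza, zero_add]

/-- A holomorphic map into the closed disc with prescribed zeros is the product of the
corresponding Blaschke product and a holomorphic map into the closed disc. -/
theorem exists_eq_prod_moeb_mul {ι : Type*} (s : Finset ι) {h : ℂ → ℂ}
    (hh : IsHolMap disc (closedBall 0 1) h) {a : ι → ℂ} (ha : ∀ i, a i ∈ disc)
    (hinj : Function.Injective a) (m : ι → ℕ) (hm : ∀ i, (m i : ℕ∞) ≤ analyticOrderAt h (a i)) :
    ∃ u : ℂ → ℂ, IsHolMap disc (closedBall 0 1) u ∧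
      (∀ z ∈ disc, h z = (∏ i ∈ s, moeb (a i) z ^ m i) * u z) ∧
      ∀ i ∉ s, analyticOrderAt u (a i) = analyticOrderAt h (a i) := by
  classical
  induction s using Finset.induction_on with
  | empty => exact ⟨h, hh, fun z _ => by simp, fun i _ => rfl⟩
  | insert j s hj ih =>
    obtain ⟨v, hv, hvfac, hvord⟩ := ih
    obtain ⟨u, hu, hufac, huord⟩ := exists_eq_moeb_pow_mul hv (ha j) (m j)
      (by rw [hvord j hj]; exact hm j)
    refine ⟨u, hu, fun z hz => ?_, fun i hi => ?_⟩
    · rw [Finset.prod_insert hj, hvfac z hz, hufac z hz]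
      ring
    · rw [Finset.mem_insert, not_or] at hi
      rw [huord (a i) (ha i) (hinj.ne hi.1), hvord i hi.2]

/-! ### Zeros of functions that are nonnegative on the real axis -/

/-- A zero of odd order would be a change of sign. -/
theorem evenCeil_le_analyticOrderAt {g : ℂ → ℂ} {x : ℝ} (hg : AnalyticAt ℂ g x)
    (hre : ∀ᶠ t : ℝ in 𝓝 x, (g t).im = 0 ∧ 0 ≤ (g t).re) {k : ℕ}
    (hk : (k : ℕ∞) ≤ analyticOrderAt g x) : (evenCeil k : ℕ∞) ≤ analyticOrderAt g x := by
  rcases eq_or_ne (analyticOrderAt g x) ⊤ with htop | htop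
  · rw [htop]; exact le_top
  obtain ⟨n, hn⟩ := ENat.ne_top_iff_exists.mp htop
  rw [← hn] at hk ⊢
  refine Nat.cast_le.mpr ((isLeast_evenCeil k).2 ⟨?_, Nat.cast_le.mp hk⟩)
  by_contra hodd
  rw [Nat.not_even_iff_odd] at hodd
  obtain ⟨u, hu, hu0, hgu⟩ := hg.analyticOrderAt_eq_natCast.mp hn.symm
  have hcont : Tendsto (fun t : ℝ => u t) (𝓝 x) (𝓝 (u x)) :=
    hu.continuousAt.tendsto.comp Complex.continuous_ofReal.continuousAt
  have hgu' : ∀ᶠ t : ℝ in 𝓝 x, g t = ((t - x : ℝ) : ℂ) ^ n * u t := by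
    have := Complex.continuous_ofReal.continuousAt.eventually hgu
    filter_upwards [this] with t ht
    rw [ht, smul_eq_mul, Complex.ofReal_sub]
  have key : ∀ᶠ t : ℝ in 𝓝 x, (t - x) ^ n * (u t).im = 0 ∧ 0 ≤ (t - x) ^ n * (u t).re := by
    filter_upwards [hgu', hre] with t h1 h2
    rw [h1, ← Complex.ofReal_pow, Complex.re_ofReal_mul, Complex.im_ofReal_mul] at h2
    exact h2
  have hgt : Tendsto (fun t : ℝ => u t) (𝓝[>] x) (𝓝 (u x)) := hcont.mono_left nhdsWithin_le_nhds
  have hlt : Tendsto (fun t : ℝ => u t) (𝓝[<] x) (𝓝 (u x)) := hcont.mono_left nhdsWithin_le_nhds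
  -- the sign of `(t - x) ^ n` on either side of `x` forces `u x = 0`
  have him : (u x).im = 0 := by
    refine tendsto_nhds_unique ((Complex.continuous_im.tendsto _).comp hgt)
      (tendsto_const_nhds.congr' ?_)
    filter_upwards [nhdsWithin_le_nhds key, self_mem_nhdsWithin] with t ht htx
    exact ((mul_eq_zero_iff_left (pow_ne_zero n (sub_pos.mpr htx).ne')).mp ht.1).symm
  have hre1 : 0 ≤ (u x).re := by
    refine ge_of_tendsto ((Complex.continuous_re.tendsto _).comp hgt) ?_
    filter_upwards [nhdsWithin_le_nhds key, self_mem_nhdsWithin] with t ht htx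
    exact nonneg_of_mul_nonneg_right ht.2 (pow_pos (sub_pos.mpr htx) n)
  have hre2 : (u x).re ≤ 0 := by
    refine le_of_tendsto ((Complex.continuous_re.tendsto _).comp hlt) ?_
    filter_upwards [nhdsWithin_le_nhds key, self_mem_nhdsWithin] with t ht htx
    have h1 : (t - x) ^ n < 0 := hodd.pow_neg (sub_neg.mpr htx)
    by_contra! h2
    exact absurd ht.2 (not_le.mpr (mul_neg_of_neg_of_pos h1 h2))
  exact hu0 (Complex.ext (le_antisymm hre2 hre1) him)

/-! ### The extremal function -/

/-- The finite Blaschke product `∏ⱼ ((φ - φ(xⱼ)) / (1 - conj φ(xⱼ) φ)) ^ r(kⱼ)`, pulled back to the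
domain of `φ`. -/
noncomputable def blaschke (φ : ℂ → ℂ) {n : ℕ} (x : Fin n → ℝ) (k : Fin n → ℕ) (z : ℂ) : ℂ :=
  ∏ j, moeb (φ (x j)) (φ z) ^ evenCeil (k j)

theorem even_evenCeil (k : ℕ) : Even (evenCeil k) := (isLeast_evenCeil k).1.1

theorem le_evenCeil (k : ℕ) : k ≤ evenCeil k := (isLeast_evenCeil k).1.2

theorem moeb_ofReal {a : ℂ} (ha : a.im = 0) (z : ℂ) : moeb a z = (z - a) / (1 - a * z) := by
  rw [moeb, Complex.conj_eq_iff_im.mpr ha]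

theorem pow_eq_norm_pow_of_im_eq_zero {z : ℂ} (hz : z.im = 0) {m : ℕ} (hm : Even m) :
    z ^ m = ((‖z‖ ^ m : ℝ) : ℂ) := by
  have h : z = (z.re : ℂ) := Complex.ext rfl hz
  rw [h, Complex.norm_real, Real.norm_eq_abs, hm.pow_abs, Complex.ofReal_pow]

theorem blaschke_ofReal {D : Set ℂ} {φ : ℂ → ℂ} {n : ℕ} {x : Fin n → ℝ} (k : Fin n → ℕ)
    (hreal : ∀ t : ℝ, (t : ℂ) ∈ D → (φ t).im = 0) (hx : ∀ j, (x j : ℂ) ∈ D) {t : ℝ}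
    (ht : (t : ℂ) ∈ D) :
    blaschke φ x k t = ((∏ j, moebiusDist (φ t) (φ (x j)) ^ evenCeil (k j) : ℝ) : ℂ) := by
  rw [blaschke, Complex.ofReal_prod]
  refine Finset.prod_congr rfl fun j _ => ?_
  have h : ∀ z : ℂ, z.im = 0 → z = (z.re : ℂ) := fun z hz => Complex.ext rfl hz
  have him : (moeb (φ (x j)) (φ t)).im = 0 := by
    rw [moeb_ofReal (hreal _ (hx j)), h _ (hreal _ (hx j)), h _ (hreal _ ht)]
    norm_cast
  rw [pow_eq_norm_pow_of_im_eq_zero him (even_evenCeil _), norm_moeb, moebiusDist_comm]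

theorem isHolMap_moeb_comp {D : Set ℂ} {φ : ℂ → ℂ} (hφ : IsHolMap D disc φ) {a : ℂ} (ha : a ∈ D) :
    IsHolMap D disc (moeb (φ a) ∘ φ) :=
  (isHolMap_moeb (hφ.2 ha)).comp hφ

theorem isHolMap_blaschke {D : Set ℂ} {φ : ℂ → ℂ} (hφ : IsHolMap D disc φ) {n : ℕ} (hn : 0 < n)
    {x : Fin n → ℝ} (hx : ∀ j, (x j : ℂ) ∈ D) {k : Fin n → ℕ} (hk : ∀ j, 0 < k j) :
    IsHolMap D disc (blaschke φ x k) := by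
  refine ⟨DifferentiableOn.fun_finsetProd fun j _ =>
    ((isHolMap_moeb_comp hφ (hx j)).1).fun_pow _, fun z hz => ?_⟩
  have hle : ∀ j, ‖moeb (φ (x j)) (φ z)‖ < 1 := fun j =>
    mem_disc.mp ((isHolMap_moeb_comp hφ (hx j)).2 hz)
  rw [mem_disc, blaschke, norm_prod, ← Finset.mul_prod_erase _ _ (Finset.mem_univ ⟨0, hn⟩)]
  simp only [norm_pow]
  exact mul_lt_one_of_nonneg_of_lt_one_left (pow_nonneg (norm_nonneg _) _)
    (pow_lt_one₀ (norm_nonneg _) (hle _) ((hk _).trans_le (le_evenCeil _)).ne')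
    (Finset.prod_le_one (fun j _ => pow_nonneg (norm_nonneg _) _) fun j _ =>
      pow_le_one₀ (norm_nonneg _) (hle j).le)

theorem blaschke_mem_classFPos {D : Set ℂ} (hD : IsOpen D) {φ : ℂ → ℂ} (hφ : IsHolMap D disc φ)
    (hreal : ∀ t : ℝ, (t : ℂ) ∈ D → (φ t).im = 0) {n : ℕ} (hn : 0 < n)
    {x : Fin n → ℝ} (hx : ∀ j, (x j : ℂ) ∈ D) {k : Fin n → ℕ} (hk : ∀ j, 0 < k j) :
    blaschke φ x k ∈ classFPos D x k := by
  have hB := isHolMap_blaschke hφ hn hx hk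
  refine ⟨⟨⟨hB, fun j => ?_⟩, fun t ht => ?_⟩, fun t ht => ?_⟩
  · rw [← natCast_le_analyticOrderAt_iff_iteratedDeriv_eq_zero (hB.analyticAt hD (hx j))]
    have hm : ∀ i, AnalyticAt ℂ (moeb (φ (x i)) ∘ φ) (x j) := fun i =>
      (isHolMap_moeb_comp hφ (hx i)).analyticAt hD (hx j)
    have hsplit : blaschke φ x k = (moeb (φ (x j)) ∘ φ) ^ evenCeil (k j) *
        ∏ i ∈ Finset.univ.erase j, (moeb (φ (x i)) ∘ φ) ^ evenCeil (k i) := by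
      rw [Finset.mul_prod_erase Finset.univ (fun i => (moeb (φ (x i)) ∘ φ) ^ evenCeil (k i))
        (Finset.mem_univ j)]
      funext z
      simp [blaschke]
    have h1 : 1 ≤ analyticOrderAt (moeb (φ (x j)) ∘ φ) (x j) :=
      Order.one_le_iff_ne_zero.mpr (analyticOrderAt_ne_zero.mpr ⟨hm j, by simp⟩)
    rw [hsplit, analyticOrderAt_mul ((hm j).pow _)
      (Finset.analyticAt_prod _ fun i _ => (hm i).pow _), analyticOrderAt_pow (hm j)]
    calc (k j : ℕ∞) ≤ (evenCeil (k j) : ℕ∞) := Nat.cast_le.mpr (le_evenCeil _)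
      _ = evenCeil (k j) • (1 : ℕ∞) := by simp
      _ ≤ evenCeil (k j) • analyticOrderAt (moeb (φ (x j)) ∘ φ) (x j) := nsmul_le_nsmul_right h1 _
      _ ≤ _ := le_self_add
  · rw [blaschke_ofReal k hreal hx ht, Complex.ofReal_im]
  · rw [blaschke_ofReal k hreal hx ht, Complex.ofReal_re]
    exact Finset.prod_nonneg fun j _ => pow_nonneg (norm_nonneg _) _

/-- Every competitor is the product of the extremal function and a map into the closed disc: its
zeros have even or infinite order, hence order at least `r(kⱼ)`, and they can be divided out after
transport to the disc. -/
theorem exists_eq_blaschke_mul {D : Set ℂ} (hD : IsOpen D) {φ : ℂ → ℂ}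
    (hφ : IsBiholomorphic D disc φ) {n : ℕ} {x : Fin n → ℝ} (hxi : Function.Injective x)
    (hx : ∀ j, (x j : ℂ) ∈ D) {k : Fin n → ℕ} {g : ℂ → ℂ} (hg : g ∈ classFPos D x k) :
    ∃ u : ℂ → ℂ, IsHolMap D (closedBall 0 1) u ∧ ∀ z ∈ D, g z = blaschke φ x k z * u z := by
  obtain ⟨⟨⟨hgh, hgx⟩, hgim⟩, hgre⟩ := hg
  have hinj := hφ.injOn
  obtain ⟨hφh, ψ, hψ, hl, hr⟩ := hφ
  have hgψ : IsHolMap disc (closedBall 0 1) (g ∘ ψ) :=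
    ⟨(hgh.comp hψ).1, fun z hz => ball_subset_closedBall ((hgh.comp hψ).2 hz)⟩
  have hord : ∀ j, (evenCeil (k j) : ℕ∞) ≤ analyticOrderAt (g ∘ ψ) (φ (x j)) := fun j => by
    have hφx := hφh.2 (hx j)
    have hψφ : ψ (φ (x j)) = x j := hl (hx j)
    have hder : deriv ψ (φ (x j)) ≠ 0 := by
      refine deriv_ne_zero_of_eventually_leftInverse (g := φ)
        (hψ.analyticAt isOpen_disc hφx).differentiableAt ?_ ?_
      · rw [hψφ]
        exact (hφh.analyticAt hD (hx j)).differentiableAt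
      · filter_upwards [isOpen_disc.mem_nhds hφx] with w hw using hr hw
    rw [analyticOrderAt_comp_of_deriv_ne_zero (hψ.analyticAt isOpen_disc hφx) hder, hψφ]
    have hgan := hgh.analyticAt hD (hx j)
    refine evenCeil_le_analyticOrderAt hgan ?_
      ((natCast_le_analyticOrderAt_iff_iteratedDeriv_eq_zero hgan).mpr (hgx j))
    filter_upwards [Complex.continuous_ofReal.continuousAt.eventually (hD.mem_nhds (hx j))]
      with t ht using ⟨hgim t ht, hgre t ht⟩
  obtain ⟨u, hu, hfac, -⟩ := exists_eq_prod_moeb_mul Finset.univ hgψ (a := fun j => φ (x j))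
    (fun j => hφh.2 (hx j))
    (fun i j hij => hxi (Complex.ofReal_injective (hinj (hx i) (hx j) hij))) _ hord
  refine ⟨u ∘ φ, ⟨hu.1.comp hφh.1 hφh.2, hu.2.comp hφh.2⟩, fun z hz => ?_⟩
  have h := hfac (φ z) (hφh.2 hz)
  rwa [Function.comp_apply, hl hz] at h

/-! ### Comparison of the integrals -/

/-- A competitor that agrees with the extremal function at a real point other than the `xⱼ` is the
extremal function, by the maximum principle applied to the quotient. -/
theorem eqOn_blaschke_of_eq_at {D : Set ℂ} (hD : IsOpen D) (hDc : IsPreconnected D) {φ : ℂ → ℂ}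
    (hφ : IsBiholomorphic D disc φ) {n : ℕ} {x : Fin n → ℝ} (hxi : Function.Injective x)
    (hx : ∀ j, (x j : ℂ) ∈ D) {k : Fin n → ℕ} {g : ℂ → ℂ} (hg : g ∈ classFPos D x k) {t : ℝ}
    (ht : (t : ℂ) ∈ D) (htx : ∀ j, t ≠ x j) (heq : g t = blaschke φ x k t) :
    EqOn g (blaschke φ x k) D := by
  obtain ⟨u, hu, hfac⟩ := exists_eq_blaschke_mul hD hφ hxi hx hg
  have hB0 : blaschke φ x k t ≠ 0 := Finset.prod_ne_zero_iff.mpr fun j _ => pow_ne_zero _ <|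
    (moeb_eq_zero_iff (hφ.1.2 (hx j)) (hφ.1.2 ht)).not.mpr fun h =>
      htx j (Complex.ofReal_injective (hφ.injOn ht (hx j) h))
  have hut : u t = 1 := by
    have h := hfac t ht
    rw [heq] at h
    exact (mul_eq_left₀ hB0).mp h.symm
  have hmax : IsMaxOn (norm ∘ u) D t := fun z hz => by
    rw [mem_ofPred_eq, Function.comp_apply, Function.comp_apply, hut, norm_one]
    exact mem_closedBall_zero_iff.mp (hu.2 hz)
  intro z hz
  have h := Complex.eqOn_of_isPreconnected_of_isMaxOn_norm hDc hD hu.1 ht hmax hz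
  rw [Function.const_apply, hut] at h
  rw [hfac z hz, h, mul_one]

theorem integral_eq_integral_re_of_mem_classFPos {D : Set ℂ}
    (hI : ∀ t ∈ Icc (-1 : ℝ) 1, (t : ℂ) ∈ D) (α : Measure ℝ) {n : ℕ} {x : Fin n → ℝ}
    {k : Fin n → ℕ} {g : ℂ → ℂ} (hg : g ∈ classFPos D x k) :
    ∫ t in Icc (-1 : ℝ) 1, g t ∂α = ((∫ t in Icc (-1 : ℝ) 1, (g t).re ∂α : ℝ) : ℂ) := by
  rw [← integral_complex_ofReal]
  exact setIntegral_congr_fun measurableSet_Icc fun t ht =>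
    Complex.ext (by simp) (by simpa using hg.1.2 t (hI t ht))

theorem integrableOn_re_of_mem_classFPos {D : Set ℂ} (hI : ∀ t ∈ Icc (-1 : ℝ) 1, (t : ℂ) ∈ D)
    (α : Measure ℝ) [IsFiniteMeasure α] {n : ℕ} {x : Fin n → ℝ} {k : Fin n → ℕ} {g : ℂ → ℂ}
    (hg : g ∈ classFPos D x k) : IntegrableOn (fun t : ℝ => (g t).re) (Icc (-1) 1) α :=
  (Complex.continuous_re.comp_continuousOn (hg.1.1.1.1.continuousOn.comp
    Complex.continuous_ofReal.continuousOn hI)).integrableOn_compact isCompact_Icc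

theorem norm_integral_of_mem_classFPos {D : Set ℂ} (hI : ∀ t ∈ Icc (-1 : ℝ) 1, (t : ℂ) ∈ D)
    (α : Measure ℝ) {n : ℕ} {x : Fin n → ℝ} {k : Fin n → ℕ} {g : ℂ → ℂ}
    (hg : g ∈ classFPos D x k) :
    ‖∫ t in Icc (-1 : ℝ) 1, g t ∂α‖ = ∫ t in Icc (-1 : ℝ) 1, (g t).re ∂α := by
  rw [integral_eq_integral_re_of_mem_classFPos hI α hg, Complex.norm_real, Real.norm_of_nonneg]
  exact setIntegral_nonneg measurableSet_Icc fun t ht => hg.2 t (hI t ht)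

theorem re_le_re_blaschke {D : Set ℂ} (hD : IsOpen D) {φ : ℂ → ℂ}
    (hφ : IsBiholomorphic D disc φ) (hreal : ∀ t : ℝ, (t : ℂ) ∈ D → (φ t).im = 0) {n : ℕ}
    {x : Fin n → ℝ} (hxi : Function.Injective x) (hx : ∀ j, (x j : ℂ) ∈ D) {k : Fin n → ℕ}
    {g : ℂ → ℂ} (hg : g ∈ classFPos D x k) {t : ℝ} (ht : (t : ℂ) ∈ D) :
    (g t).re ≤ (blaschke φ x k t).re := by
  obtain ⟨u, hu, hfac⟩ := exists_eq_blaschke_mul hD hφ hxi hx hg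
  have hB := blaschke_ofReal k hreal hx ht
  have hnn : (0 : ℝ) ≤ ∏ j, moebiusDist (φ t) (φ (x j)) ^ evenCeil (k j) :=
    Finset.prod_nonneg fun j _ => pow_nonneg (norm_nonneg _) _
  refine (Complex.re_le_norm _).trans ?_
  rw [hfac t ht, norm_mul, hB, Complex.norm_real, Real.norm_of_nonneg hnn, Complex.ofReal_re]
  exact mul_le_of_le_one_right hnn (mem_closedBall_zero_iff.mp (hu.2 ht))

theorem JPos_eq_integral_blaschke {D : Set ℂ} (hD : IsOpen D)
    (hI : ∀ t ∈ Icc (-1 : ℝ) 1, (t : ℂ) ∈ D) (α : Measure ℝ) [IsFiniteMeasure α] {φ : ℂ → ℂ}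
    (hφ : IsBiholomorphic D disc φ) (hreal : ∀ t : ℝ, (t : ℂ) ∈ D → (φ t).im = 0) {n : ℕ}
    (hn : 0 < n) {x : Fin n → ℝ} (hxi : Function.Injective x) (hx : ∀ j, (x j : ℂ) ∈ D)
    {k : Fin n → ℕ} (hk : ∀ j, 0 < k j) :
    JPos D α x k = ∫ t in Icc (-1 : ℝ) 1, (blaschke φ x k t).re ∂α := by
  have hB := blaschke_mem_classFPos hD hφ.1 hreal hn hx hk
  refine IsGreatest.csSup_eq ⟨⟨_, hB, (norm_integral_of_mem_classFPos hI α hB).symm⟩, ?_⟩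
  rintro _ ⟨g, hg, rfl⟩
  rw [norm_integral_of_mem_classFPos hI α hg]
  exact setIntegral_mono_on (integrableOn_re_of_mem_classFPos hI α hg)
    (integrableOn_re_of_mem_classFPos hI α hB) measurableSet_Icc fun t ht =>
      re_le_re_blaschke hD hφ hreal hxi hx hg (hI t ht)

/-- Equal integrals force equality almost everywhere, hence at some point other than the `xⱼ`, since
`α` has no atoms. -/
theorem eqOn_blaschke_of_integral_eq {D : Set ℂ} (hD : IsOpen D) (hDc : IsPreconnected D)
    (hI : ∀ t ∈ Icc (-1 : ℝ) 1, (t : ℂ) ∈ D) (α : Measure ℝ) [IsFiniteMeasure α]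
    (hα : α (Icc (-1 : ℝ) 1) ≠ 0) (hαac : α ≪ volume) {φ : ℂ → ℂ}
    (hφ : IsBiholomorphic D disc φ) (hreal : ∀ t : ℝ, (t : ℂ) ∈ D → (φ t).im = 0) {n : ℕ}
    (hn : 0 < n) {x : Fin n → ℝ} (hxi : Function.Injective x) (hx : ∀ j, (x j : ℂ) ∈ D)
    {k : Fin n → ℕ} (hk : ∀ j, 0 < k j) {g : ℂ → ℂ} (hg : g ∈ classFPos D x k)
    (heq : ∫ t in Icc (-1 : ℝ) 1, (g t).re ∂α = ∫ t in Icc (-1 : ℝ) 1, (blaschke φ x k t).re ∂α) :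
    EqOn g (blaschke φ x k) D := by
  have hB := blaschke_mem_classFPos hD hφ.1 hreal hn hx hk
  have hle : (fun t : ℝ => (g t).re) ≤ᵐ[α.restrict (Icc (-1) 1)]
      fun t => (blaschke φ x k t).re :=
    (ae_restrict_iff' measurableSet_Icc).mpr (Eventually.of_forall fun t ht =>
      re_le_re_blaschke hD hφ hreal hxi hx hg (hI t ht))
  have hae := (integral_eq_iff_of_ae_le (integrableOn_re_of_mem_classFPos hI α hg)
    (integrableOn_re_of_mem_classFPos hI α hB) hle).mp heq
  have hnull : α (range x) = 0 := hαac ((finite_range x).measure_zero volume)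
  have hae' : ∀ᵐ t ∂α.restrict (Icc (-1) 1), t ∉ range x :=
    ae_restrict_of_ae (measure_eq_zero_iff_ae_notMem.mp hnull)
  have : (ae (α.restrict (Icc (-1) 1))).NeBot :=
    ae_neBot.mpr (Measure.restrict_eq_zero.not.mpr hα)
  obtain ⟨t, h1, h2, ht⟩ := (hae.and (hae'.and (ae_restrict_mem measurableSet_Icc))).exists
  refine eqOn_blaschke_of_eq_at hD hDc hφ hxi hx hg (hI t ht) (fun j h => h2 ⟨j, h.symm⟩)
    (Complex.ext h1 ?_)
  rw [hg.1.2 t (hI t ht), hB.1.2 t (hI t ht)]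

/-! ### The extremal problem -/

theorem mainTheorem2
    (D : Set ℂ) (hDo : IsOpen D) (hDsc : IsSimplyConnected D) (hDne : D ≠ Set.univ)
    (hDsymm : ∀ z : ℂ, z ∈ D ↔ (starRingEnd ℂ) z ∈ D)
    (hDI : ∀ t ∈ Set.Icc (-1 : ℝ) 1, (t : ℂ) ∈ D)
    (α : MeasureTheory.Measure ℝ) [MeasureTheory.IsFiniteMeasure α]
    (hαI : α (Set.Icc (-1 : ℝ) 1)ᶜ = 0) (hα0 : α ≠ 0)
    (hαac : α.AbsolutelyContinuous MeasureTheory.volume)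
    (n : ℕ) (hn : 0 < n)
    (x : Fin n → ℝ) (hx : StrictMono x) (hxI : ∀ j, x j ∈ Set.Icc (-1 : ℝ) 1)
    (k : Fin n → ℕ) (hk : ∀ j, 0 < k j) :
    ∃ fD : ℂ → ℂ, IsNormalizedRiemannMap D fD ∧
      (∀ φ : ℂ → ℂ, IsNormalizedRiemannMap D φ → Set.EqOn φ fD D) ∧
      (∃ f ∈ classFPos D x k,
        (∫ t in Set.Icc (-1 : ℝ) 1, f (t : ℂ) ∂α) = ((JPos D α x k : ℝ) : ℂ) ∧
        (∀ g ∈ classFPos D x k,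
          (∫ t in Set.Icc (-1 : ℝ) 1, g (t : ℂ) ∂α) = ((JPos D α x k : ℝ) : ℂ) →
            Set.EqOn g f D) ∧
        (∀ z ∈ D, f z =
          ∏ j, ((fD z - fD (x j : ℂ)) / (1 - fD (x j : ℂ) * fD z)) ^ evenCeil (k j))) ∧
      JPos D α x k =
        ∫ t in Set.Icc (-1 : ℝ) 1,
          ∏ j, caratheodoryStar D (t : ℂ) (x j : ℂ) ^ evenCeil (k j) ∂α ∧
      JPos D α x k =
        ∫ t in Set.Icc (-1 : ℝ) 1,
          ∏ j, moebiusDist (fD (t : ℂ)) (fD (x j : ℂ)) ^ evenCeil (k j) ∂α := by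
  have h0 : (0 : ℂ) ∈ D := by simpa using hDI 0 (by simp)
  have h1 : (1 : ℂ) ∈ D := by simpa using hDI 1 (by simp)
  obtain ⟨φ, hφ⟩ := exists_isNormalizedRiemannMap hDo hDsc hDne hDsymm fun t ht =>
    hDI t ⟨by linarith [ht.1], ht.2⟩
  have hreal : ∀ t : ℝ, (t : ℂ) ∈ D → (φ t).im = 0 := fun t ht =>
    hφ.im_eq_zero hDo hDsymm h0 h1 ht
  have hxD : ∀ j, (x j : ℂ) ∈ D := fun j => hDI _ (hxI j)
  have hα : α (Icc (-1 : ℝ) 1) ≠ 0 := fun h => hα0 <| Measure.measure_univ_eq_zero.mp <| by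
    rw [← union_compl_self (Icc (-1 : ℝ) 1)]
    exact measure_union_null h hαI
  have hB := blaschke_mem_classFPos hDo hφ.1.1 hreal hn hxD hk
  have hJ := JPos_eq_integral_blaschke hDo hDI α hφ.1 hreal hn hx.injective hxD hk
  have hJm : JPos D α x k = ∫ t in Icc (-1 : ℝ) 1,
      ∏ j, moebiusDist (φ (t : ℂ)) (φ (x j : ℂ)) ^ evenCeil (k j) ∂α := by
    rw [hJ]
    refine setIntegral_congr_fun measurableSet_Icc fun t ht => ?_
    simp only [blaschke_ofReal k hreal hxD (hDI t ht), Complex.ofReal_re]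
  refine ⟨φ, hφ, fun ψ hψ => hψ.eqOn h0 h1 hφ, ⟨blaschke φ x k, hB, ?_, fun g hg hgJ => ?_,
    fun z _ => ?_⟩, ?_, hJm⟩
  · rw [integral_eq_integral_re_of_mem_classFPos hDI α hB, hJ]
  · rw [integral_eq_integral_re_of_mem_classFPos hDI α hg, hJ] at hgJ
    exact eqOn_blaschke_of_integral_eq hDo hDsc.isPathConnected.isConnected.isPreconnected hDI α hα
      hαac hφ.1 hreal hn hx.injective hxD hk hg (Complex.ofReal_injective hgJ)
  · exact Finset.prod_congr rfl fun j _ => by rw [moeb_ofReal (hreal _ (hxD j))]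
  · rw [hJm]
    refine setIntegral_congr_fun measurableSet_Icc fun t ht => ?_
    exact Finset.prod_congr rfl fun j _ => by
      rw [caratheodoryStar_eq_moebiusDist hφ.1 (hDI t ht) (hxD j)]
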